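/- Let $[k]=\{1,\dots,k\}$, let $\Delta_k\subset\mathbb{R}^k$ be the set of probability distributions on $[k]$, and for $q\in\mathbb{R}^k$ let $C(q)=\sum_{x} q_x^2$. A distribution estimator $A$ with $n$ users is a protocol with finitely many rounds between a server and $n$ users, where user $i$ holds $x_i\in[k]$ (each message takes values in a standard Borel space, is sent by one user or by the server, and has a law depending only on the earlier messages and, if user $i$ sends it, on $x_i$), followed by an estimate $A(x_1,\dots,x_n)\in\mathbb{R}^k$ that is a measurable function of the transcript of all messages. It is $(\alpha,\beta)$-locally differentially private (LDP) if, for all samples and every measurable set $O$ of transcripts, changing the sample of one user changes the probability $P$ of $O$ to some $P'$ with $P\le e^{\alpha}P'+\beta$. Its worst-case risk is $R(A)=\sup_{\mathbf p\in\Delta_k}\mathbb{E}\,\|A(x_1,\dots,x_n)-\mathbf p\|_1$, where $x_1,\dots,x_n$ are drawn independently from $\mathbf p$. The $k$-RAPPOR estimator $A^*_n$: each user $i$ sends $\hat v_i\in\{0,1\}^k$, obtained from the indicator vector of $x_i$ by flipping each bit independently with probability $\frac{1}{e^{\alpha/2}+1}$; the estimate is $\tilde p_x=\frac{e^{\alpha/2}+1}{e^{\alpha/2}-1}\cdot\frac1n\sum_{i}\hat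 v_{i,x}-\frac{1}{e^{\alpha/2}-1}$ for $x\in[k]$. There are universal constants $K,c>0$ such that for all $\alpha\in(0,1)$ and all $k\ge2$: 1. $k$-RAPPOR is $(\alpha,0)$-minimax optimal up to the constant factor $K$: it is $(\alpha,0)$-LDP; for every $n\ge1$ and every $(\alpha,0)$-LDP estimator $B$ with $n$ users, $\min\{2,R(A^*_n)\}\le K\,R(B)$; and for every $\tau\in(0,\frac12]$, if some $(\alpha,0)$-LDP estimator with $m$ users has worst-case risk at most $\tau$, then $R(A^*_n)\le\tau$ for all $n\ge Km$. 2. For the uniform distribution $\mathbf p\in\Delta_k$, all $n\ge1$ and all $\varepsilon>0$: if $x_1,\dots,x_n$ are drawn independently from $\mathbf p$ and $\mathbb{E}\left[\left|C(A^*_n(x_1,\dots,x_n))-C(\mathbf p)\right|\right]\le\varepsilon$, then $n\ge c\,\min\left\{\frac{k^2}{\alpha^2},\frac{k}{\alpha^2\varepsilon}\right\}$. -/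

import Mathlib

open MeasureTheory ProbabilityTheory
open scoped ENNReal

noncomputable section

namespace LDP

/-- A (fully interactive) local protocol in which `n` users, each holding one sample from
`[k] = Fin k`, communicate with a server, followed by an estimator of a vector indexed by `[k]`.

The protocol runs for finitely many rounds. In round `r` the message is sent by the user `i` if
`speaker r = some i`, and by the server if `speaker r = none`; its law may depend on all earlier
messages and, if it is sent by user `i`, on the sample of user `i`, but on no other sample. (Allowing
`Msg` to contain an empty message, this covers protocols whose schedule is adaptive; randomness
shared by the users is a message of the server.) The server estimates from the whole transcript. -/
structure Protocol (k n : ℕ) where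
  /-- number of rounds -/
  rounds : ℕ
  /-- the message space -/
  Msg : Type
  [mMsg : MeasurableSpace Msg]
  [borelMsg : StandardBorelSpace Msg]
  /-- who sends the message of a round; `none` is the server -/
  speaker : ℕ → Option (Fin n)
  /-- law of the message of round `r` given the messages of rounds `0, …, r - 1`, when the sender
  holds the sample `some x`, or is the server (`none`) -/
  step : (r : ℕ) → Option (Fin k) → Kernel (Fin r → Msg) Msg
  markov : ∀ r o, IsMarkovKernel (step r o)
  /-- the estimate, a function of the transcript -/
  est : (Fin rounds → Msg) → (Fin k → ℝ)
  measurable_est : Measurable est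

attribute [instance] Protocol.mMsg Protocol.borelMsg Protocol.markov

namespace Protocol

variable {k n : ℕ}

/-- The law of the messages of the first `r` rounds when the samples of the users are `x`. -/
def lawUpTo (A : Protocol k n) (x : Fin n → Fin k) : (r : ℕ) → Measure (Fin r → A.Msg)
  | 0 => Measure.dirac Fin.elim0
  | r + 1 => (A.lawUpTo x r ⊗ₘ A.step r ((A.speaker r).map x)).map
      (fun hm => (Fin.snoc hm.1 hm.2 : Fin (r + 1) → A.Msg))

/-- The law of the entire transcript when the samples of the users are `x`. -/
def law (A : Protocol k n) (x : Fin n → Fin k) : Measure (Fin A.rounds → A.Msg) :=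
  A.lawUpTo x A.rounds

/-- `(α, β)`-local differential privacy: changing the sample of one user changes the law of the
entire transcript only slightly. -/
def IsLDP (A : Protocol k n) (α β : ℝ) : Prop :=
  ∀ (x : Fin n → Fin k) (i : Fin n) (y : Fin k) (O : Set (Fin A.rounds → A.Msg)),
    MeasurableSet O →
      A.law x O ≤ ENNReal.ofReal (Real.exp α) * A.law (Function.update x i y) O
        + ENNReal.ofReal β

/-- The law of the transcript when the samples of the users are drawn independently from `p`. -/
def lawUnder (A : Protocol k n) (p : Fin k → ℝ) : Measure (Fin A.rounds → A.Msg) :=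
  ∑ x : Fin n → Fin k, (∏ i, ENNReal.ofReal (p (x i))) • A.law x

/-- The expected `ℓ₁` error of the estimate when the samples are drawn independently from `p`. -/
def risk (A : Protocol k n) (p : Fin k → ℝ) : ℝ≥0∞ :=
  ∫⁻ t, ENNReal.ofReal (∑ x, |A.est t x - p x|) ∂(A.lawUnder p)

/-- The maximum of the expected `ℓ₁` error over all distributions `p` on `[k]`. -/
def worstRisk (A : Protocol k n) : ℝ≥0∞ :=
  ⨆ p ∈ stdSimplex ℝ (Fin k), A.risk p

end Protocol

/-- The collision probability `C(q) = ∑ x, q x ^ 2`. -/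
def collision {k : ℕ} (q : Fin k → ℝ) : ℝ := ∑ x, q x ^ 2

/-- The expected error of the plug-in estimate of the collision probability of `p` when the samples
are drawn independently from `p`. -/
def Protocol.collisionError {k n : ℕ} (A : Protocol k n) (p : Fin k → ℝ) : ℝ≥0∞ :=
  ∫⁻ t, ENNReal.ofReal |collision (A.est t) - collision p| ∂(A.lawUnder p)

/-- The distribution estimator `A`, given for each number `n` of users, is `(α, β)`-minimax optimal
up to the constant factor `K`, among all `(α, β)`-locally differentially private estimators:

* it is `(α, β)`-locally differentially private;
* for each `n ≥ 1`, its worst-case risk, capped at the `ℓ₁`-diameter `2` of the simplex, is at most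
  `K` times that of any competitor;
* for each accuracy `0 < τ ≤ 1 / 2`, it needs at most `K` times as many users as any competitor
  in order to have worst-case risk at most `τ`. -/
structure IsMinimaxOptimalWithin {k : ℕ} (K α β : ℝ) (A : (n : ℕ) → Protocol k n) : Prop where
  isLDP : ∀ n, (A n).IsLDP α β
  risk_le : ∀ n : ℕ, 1 ≤ n → ∀ B : Protocol k n, B.IsLDP α β →
    min 2 (A n).worstRisk ≤ ENNReal.ofReal K * B.worstRisk
  samples_le : ∀ τ : ℝ, 0 < τ → τ ≤ 1 / 2 → ∀ (m : ℕ) (B : Protocol k m), B.IsLDP α β →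
    B.worstRisk ≤ ENNReal.ofReal τ →
      ∀ n : ℕ, K * m ≤ n → (A n).worstRisk ≤ ENNReal.ofReal τ

/-- The law of the bit `b` after it is flipped with probability `1 / (e ^ (α / 2) + 1)`. -/
def flipLaw (α : ℝ) (b : Bool) : Measure Bool :=
  ENNReal.ofReal (Real.exp (α / 2) / (Real.exp (α / 2) + 1)) • Measure.dirac b
    + ENNReal.ofReal (1 / (Real.exp (α / 2) + 1)) • Measure.dirac (!b)

instance (α : ℝ) (b : Bool) : IsProbabilityMeasure (flipLaw α b) := by
  constructor
  have h : 0 < Real.exp (α / 2) := Real.exp_pos _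
  simp only [flipLaw, Measure.add_apply, Measure.smul_apply, measure_univ, smul_eq_mul, mul_one]
  rw [← ENNReal.ofReal_add (by positivity) (by positivity), ← add_div, div_self (by positivity),
    ENNReal.ofReal_one]

/-- The law of the message of a user with sample `x`: the bits of the indicator vector of `x`
are flipped independently. -/
def rapporMsg (α : ℝ) {k : ℕ} (x : Fin k) : Measure (Fin k → Bool) :=
  Measure.pi fun y => flipLaw α (decide (y = x))

instance (α : ℝ) {k : ℕ} (x : Fin k) : IsProbabilityMeasure (rapporMsg α x) := by
  unfold rapporMsg; infer_instance

/-- The `k`-RAPPOR estimator. Each user once sends a noisy version of the indicator vector of its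
sample, whatever the others sent (the server sends nothing, so the value at `none` is never used).
The estimate is `a * phat - b`, where `phat` is the average of the messages. -/
def kRappor (α : ℝ) (k n : ℕ) : Protocol k n where
  rounds := n
  Msg := Fin k → Bool
  speaker r := if h : r < n then some ⟨r, h⟩ else none
  step r o := Kernel.const _ (o.elim (Measure.dirac fun _ => false) fun x => rapporMsg α x)
  markov r o := by cases o <;> (dsimp only [Option.elim]; infer_instance)
  est t y :=
    (Real.exp (α / 2) + 1) / (Real.exp (α / 2) - 1)
        * ((∑ i, if t i y then (1 : ℝ) else 0) / n)
      - 1 / (Real.exp (α / 2) - 1)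
  measurable_est := measurable_of_finite _

/-- The uniform distribution on `[k]`. -/
def uniform (k : ℕ) : Fin k → ℝ := fun _ => 1 / k

end LDP

end

namespace LDP

open scoped NNReal

/-! The worst-case `ℓ₁` risk under `(α, 0)`-privacy is of order `k / (α √n)`, capped at a constant.
For the upper bound, each coordinate of the `k`-RAPPOR estimate is unbiased with variance at most `9
/ (α² n)`; summing the standard deviations gives `kRappor_worstRisk_le`.

The lower bound is Assouad's method. The transcript law of any interactive protocol has a density
that is a product over users of factors `f i (x i)` (`Protocol.exists_density`), and privacy forces
`f i x ≤ e^α f i y` almost everywhere where the densities do not all vanish. When i.i.d. samples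
change law from `p` to `q` by moving a mass `c`, each factor `∑ x, p x * f i x` changes by a
relative amount at most `D = |c| (e^α - 1)`. The overlap of the two transcript laws is bounded below
through the logarithm of the likelihood ratio (`le_min_prod`). Its first-order terms are differences
between `P` and the densities in which a single user samples from `q`; those are probability
densities too, so the terms integrate to zero and only `O(n D²)` remains, however interactive the
protocol. This is `three_fourths_le_integral_min`, and a hypercube of perturbed distributions turns
it into `Protocol.IsLDP.le_worstRisk`.

For the collision probability, unbiasedness makes the bias of the plug-in estimate equal to the sum
of the coordinate variances, which is at least `k / (α² n)` (`le_kRappor_collisionError`). -/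

/-! ### Transcript laws have densities that factor over the users -/

theorem measurable_snoc (r : ℕ) (M : Type*) [MeasurableSpace M] :
    Measurable (fun hm : (Fin r → M) × M => (Fin.snoc hm.1 hm.2 : Fin (r + 1) → M)) := by
  refine measurable_pi_lambda _ fun i => ?_
  refine Fin.lastCases ?_ (fun j => ?_) i
  · simpa using measurable_snd
  · simp only [Fin.snoc_castSucc]
    exact (measurable_pi_apply j).comp measurable_fst

theorem measurable_finInit (r : ℕ) (M : Type*) [MeasurableSpace M] :
    Measurable (fun t : Fin (r + 1) → M => (fun i : Fin r => t i.castSucc)) :=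
  measurable_pi_lambda _ fun _ => measurable_pi_apply _

/-- Inductive step of the factorisation: appending a message multiplies the transcript density by
the conditional density of that message. Both sides are tested against nonnegative functions. -/
theorem map_snoc_compProd_withDensity {r : ℕ} {M : Type*} [MeasurableSpace M]
    (ν : Measure (Fin r → M)) [IsFiniteMeasure ν] (η κ : Kernel (Fin r → M) M)
    [IsFiniteKernel η] [IsFiniteKernel κ]
    {F : (Fin r → M) → ℝ≥0∞} (hF : Measurable F)
    {d : (Fin r → M) → M → ℝ≥0∞} (hd : Measurable (Function.uncurry d))
    (hκ : ∀ h, κ h = (η h).withDensity (d h)) :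
    ((ν.withDensity F) ⊗ₘ κ).map (fun hm => (Fin.snoc hm.1 hm.2 : Fin (r + 1) → M)) =
      ((ν ⊗ₘ η).map (fun hm => (Fin.snoc hm.1 hm.2 : Fin (r + 1) → M))).withDensity
        (fun t => F (fun i => t i.castSucc) * d (fun i => t i.castSucc) (t (Fin.last r))) := by
  have hm := measurable_snoc r M
  have hden : Measurable (fun t : Fin (r + 1) → M =>
      F (fun i => t i.castSucc) * d (fun i => t i.castSucc) (t (Fin.last r))) :=
    (hF.comp (measurable_finInit r M)).mul
      (hd.comp ((measurable_finInit r M).prodMk (measurable_pi_apply _)))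
  refine Measure.ext_of_lintegral _ fun g hg => ?_
  rw [lintegral_map hg hm, lintegral_withDensity_eq_lintegral_mul _ hden hg,
    lintegral_map (hden.mul hg) hm,
    Measure.lintegral_compProd (f := fun hm => g (Fin.snoc hm.1 hm.2)) (hg.comp hm),
    Measure.lintegral_compProd (f := fun hm => (_ * g) (Fin.snoc hm.1 hm.2))
      ((hden.mul hg).comp hm)]
  have hin : Measurable fun h => ∫⁻ m, g (Fin.snoc h m) ∂(κ h) :=
    (hg.comp hm).lintegral_kernel_prod_right' (κ := κ)
  rw [lintegral_withDensity_eq_lintegral_mul _ hF hin]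
  refine lintegral_congr fun h => ?_
  have hdh : Measurable (d h) := hd.comp measurable_prodMk_left
  have hgh : Measurable fun m => g (Fin.snoc h m) := (hg.comp hm).comp measurable_prodMk_left
  simp only [Pi.mul_apply, Fin.snoc_castSucc, Fin.snoc_last]
  rw [hκ, lintegral_withDensity_eq_lintegral_mul _ hdh hgh, ← lintegral_const_mul _ (hdh.mul hgh)]
  simp only [Pi.mul_apply, mul_assoc]

/-- The sum of the finitely many kernels dominates each of them, and a countably generated message
space makes the Radon–Nikodym derivatives jointly measurable in history and message. -/
theorem exists_nnreal_density {H M ι : Type*} [MeasurableSpace H] [MeasurableSpace M]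
    [MeasurableSpace.CountablyGenerated M] [Fintype ι] (κ : ι → Kernel H M)
    [∀ x, IsFiniteKernel (κ x)] :
    ∃ η : Kernel H M, IsFiniteKernel η ∧ ∃ d : ι → H → M → ℝ≥0,
      (∀ x, Measurable (Function.uncurry (d x))) ∧
      ∀ x h, κ x h = (η h).withDensity (fun m => d x h m) := by
  classical
  have hfin : IsFiniteKernel (∑ x, κ x) := by
    refine ⟨∑ x, (κ x).bound, ENNReal.sum_lt_top.2 fun x _ => (κ x).bound_lt_top, fun h => ?_⟩
    rw [_root_.sum_apply, Measure.finsetSum_apply]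
    exact Finset.sum_le_sum fun x _ => Kernel.measure_le_bound _ _ _
  refine ⟨∑ x, κ x, hfin, fun x h m => (Kernel.rnDeriv (κ x) (∑ x, κ x) h m).toNNReal,
    fun x => ?_, fun x h => ?_⟩
  · exact (Kernel.measurable_rnDeriv _ _).ennreal_toNNReal
  · have hac : κ x h ≪ (∑ x, κ x) h := by
      refine Measure.absolutelyContinuous_of_le ?_
      rw [_root_.sum_apply]
      exact Finset.single_le_sum (f := fun x => κ x h) (fun _ _ => Measure.zero_le _) (Finset.mem_univ x)
    rw [← Kernel.withDensity_rnDeriv_eq hac,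
      Kernel.withDensity_apply _ (Kernel.measurable_rnDeriv _ _)]
    refine withDensity_congr_ae ?_
    filter_upwards [Kernel.rnDeriv_ne_top (κ x) (∑ x, κ x) (a := h)] with m hm
    exact (ENNReal.coe_toNNReal hm).symm

/-- The law of the transcript has, with respect to a measure not depending on the samples, a density
that is a product over the users. -/
theorem Protocol.exists_density {k n : ℕ} (A : Protocol k n) (r : ℕ) :
    ∃ ν : Measure (Fin r → A.Msg), IsFiniteMeasure ν ∧
      ∃ f : Fin n → Fin k → (Fin r → A.Msg) → ℝ≥0, (∀ i x, Measurable (f i x)) ∧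
        ∀ x, A.lawUpTo x r = ν.withDensity (fun t => ∏ i, (f i (x i) t : ℝ≥0∞)) := by
  classical
  induction r with
  | zero =>
    refine ⟨Measure.dirac Fin.elim0, inferInstance, fun _ _ _ => 1, fun _ _ => measurable_const,
      fun x => ?_⟩
    simp [Protocol.lawUpTo]
  | succ r ih =>
    obtain ⟨ν, hν, f, hf, hlaw⟩ := ih
    have hF : ∀ x : Fin n → Fin k, Measurable fun t => ∏ i, (f i (x i) t : ℝ≥0∞) := fun x =>
      Finset.measurable_fun_prod _ fun i _ => (hf i (x i)).coe_nnreal_ennreal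
    cases hs : A.speaker r with
    | none =>
      -- A server message depends on no sample, so its kernel extends the reference measure and the
      -- factors stay the same.
      refine ⟨(ν ⊗ₘ A.step r none).map (fun hm => (Fin.snoc hm.1 hm.2 : Fin (r + 1) → A.Msg)),
        inferInstance, fun i x t => f i x (fun j => t j.castSucc),
        fun i x => (hf i x).comp (measurable_finInit r _), fun x => ?_⟩
      have := map_snoc_compProd_withDensity ν (A.step r none) (A.step r none) (hF x)
        (d := fun _ _ => 1) measurable_const (fun h => by simp)
      simp only [Protocol.lawUpTo, hs, Option.map_none, hlaw, this, mul_one]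
    | some j =>
      obtain ⟨η, hη, d, hd, hκ⟩ := exists_nnreal_density fun x : Fin k => A.step r (some x)
      -- Only the factor of the speaker `j` acquires the density of the new message.
      refine ⟨(ν ⊗ₘ η).map (fun hm => (Fin.snoc hm.1 hm.2 : Fin (r + 1) → A.Msg)),
        inferInstance, fun i x t => f i x (fun j => t j.castSucc) *
          (if i = j then d x (fun j => t j.castSucc) (t (Fin.last r)) else 1),
        fun i x => ?_, fun x => ?_⟩
      · refine ((hf i x).comp (measurable_finInit r _)).mul ?_
        split_ifs
        · exact (hd x).comp ((measurable_finInit r _).prodMk (measurable_pi_apply _))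
        · exact measurable_const
      · have := map_snoc_compProd_withDensity ν η (A.step r (some (x j))) (hF x)
          (d := fun h m => d (x j) h m) (hd (x j)).coe_nnreal_ennreal (hκ (x j))
        simp only [Protocol.lawUpTo, hs, Option.map_some, hlaw, this]
        congr 1
        ext t
        simp only [ENNReal.coe_mul, Finset.prod_mul_distrib]
        congr 1
        rw [Finset.prod_eq_single j]
        · simp
        · intro i _ hi
          simp [hi]
        · simp

instance Protocol.isProbabilityMeasure_lawUpTo {k n : ℕ} (A : Protocol k n) (x : Fin n → Fin k)
    (r : ℕ) : IsProbabilityMeasure (A.lawUpTo x r) := by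
  induction r with
  | zero => unfold Protocol.lawUpTo; infer_instance
  | succ r ih =>
    unfold Protocol.lawUpTo
    exact Measure.isProbabilityMeasure_map (measurable_snoc r _).aemeasurable

/-! ### Pointwise inequalities for likelihood ratios -/

/-- With `u` the square root of a likelihood ratio, this bounds the overlap by a Hellinger-type
term. It is AM-GM, `2 (1 - u) ≤ l + (1 - u)² / l`, applied to `u² = 1 - 2 (1 - u) + (1 - u)²`. -/
theorem one_sub_le_min_one_sq {u l : ℝ} (hl : 0 < l) :
    1 - l - (1 - u) ^ 2 / l ≤ min 1 (u ^ 2) := by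
  have h0 : 0 ≤ (1 - u) ^ 2 / l := by positivity
  rw [le_min_iff]
  refine ⟨by linarith, ?_⟩
  have h2 : 2 * (1 - u) ≤ l + (1 - u) ^ 2 / l := by
    have : 0 ≤ (l - (1 - u)) ^ 2 / l := by positivity
    have h3 : (l - (1 - u)) ^ 2 / l = l - 2 * (1 - u) + (1 - u) ^ 2 / l := by
      field_simp; ring
    linarith
  nlinarith [sq_nonneg (1 - u)]

theorem sub_three_mul_sq_le_log {d : ℝ} (hd : 1 ≤ 3 * (1 + d)) :
    d - 3 * d ^ 2 ≤ Real.log (1 + d) := by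
  have hpos : 0 < 1 + d := by linarith
  have h := Real.one_sub_inv_le_log_of_pos hpos
  refine le_trans ?_ h
  have h1 : 1 - (1 + d)⁻¹ = d - d ^ 2 * (1 + d)⁻¹ := by field_simp; ring
  have h2 : (1 + d)⁻¹ ≤ 3 := by
    rw [inv_le_comm₀ hpos (by norm_num)]; linarith
  rw [h1]
  nlinarith [mul_le_mul_of_nonneg_left h2 (sq_nonneg d)]

/-- A lower bound for the minimum of two products that is linear in the products in which at most
one factor, or all factors, of the first are replaced. -/
theorem le_min_prod {ι : Type*} [Fintype ι] [DecidableEq ι] {a b : ι → ℝ} {D l : ℝ}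
    (ha : ∀ i, 0 < a i) (hab : ∀ i, |b i - a i| ≤ D * a i) (hba : ∀ i, a i ≤ 3 * b i)
    (hl : 0 < l) :
    (1 - l) * ∏ i, a i - (∏ i, b i - ∏ i, a i
      - ∑ i, (∏ j, Function.update a i (b i) j - ∏ j, a j)
      + 3 * Fintype.card ι * D ^ 2 * ∏ i, a i) / l ≤ min (∏ i, a i) (∏ i, b i) := by
  set P := ∏ i, a i with hP
  have hPpos : 0 < P := Finset.prod_pos fun i _ => ha i
  have hbpos : ∀ i, 0 < b i := fun i => by linarith [ha i, hba i]
  set d : ι → ℝ := fun i => b i / a i - 1 with hd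
  have hd1 : ∀ i, 1 + d i = b i / a i := fun i => by simp [hd]
  have hdpos : ∀ i, 0 < 1 + d i := fun i => by rw [hd1]; exact div_pos (hbpos i) (ha i)
  set L := ∏ i, (1 + d i) with hL
  have hLpos : 0 < L := Finset.prod_pos fun i _ => hdpos i
  have hQ : ∏ i, b i = P * L := by
    rw [hP, hL, ← Finset.prod_mul_distrib]
    refine Finset.prod_congr rfl fun i _ => ?_
    rw [hd1, mul_div_cancel₀ _ (ha i).ne']
  -- The first-order term `P * d i` is a difference of two products, hence linear in densities once
  -- integrated.
  have hM : ∀ i, ∏ j, Function.update a i (b i) j - P = P * d i := fun i => by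
    rw [Finset.prod_update_of_mem (Finset.mem_univ i), hP,
      ← Finset.mul_prod_erase _ _ (Finset.mem_univ i), ← Finset.erase_eq]
    have := (ha i).ne'
    simp only [hd]
    field_simp
  have hdD : ∀ i, (d i) ^ 2 ≤ D ^ 2 := fun i => by
    have : |d i| ≤ D := by
      have h1 : d i = (b i - a i) / a i := by
        have := (ha i).ne'
        simp only [hd]; field_simp
      rw [h1, abs_div, abs_of_pos (ha i), div_le_iff₀ (ha i)]
      exact hab i
    exact sq_le_sq' (by linarith [abs_le.1 this]) (abs_le.1 this).2
  set u := Real.sqrt L with hu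
  have huu : u ^ 2 = L := Real.sq_sqrt hLpos.le
  have hlogu : Real.log u = (∑ i, Real.log (1 + d i)) / 2 := by
    rw [hu, Real.log_sqrt hLpos.le, hL, Real.log_prod fun i _ => (hdpos i).ne']
  have hul : 1 + Real.log u ≤ u := by
    have := Real.log_le_sub_one_of_pos (Real.sqrt_pos.2 hLpos)
    linarith
  have hsum : ∑ i, d i - 3 * Fintype.card ι * D ^ 2 ≤ ∑ i, Real.log (1 + d i) := by
    have h1 : ∑ i, (d i - 3 * D ^ 2) ≤ ∑ i, Real.log (1 + d i) := by
      refine Finset.sum_le_sum fun i _ => ?_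
      refine le_trans ?_ (sub_three_mul_sq_le_log (d := d i) ?_)
      · linarith [hdD i]
      · rw [hd1, ← mul_div_assoc, le_div_iff₀ (ha i), one_mul]
        exact hba i
    rw [Finset.sum_sub_distrib, Finset.sum_const, Finset.card_univ, nsmul_eq_mul] at h1
    linarith
  have hmin := one_sub_le_min_one_sq (u := Real.sqrt L) hl
  rw [← hu, huu] at hmin
  have hmm : min P (∏ i, b i) = P * min 1 L := by
    rw [hQ, mul_min_of_nonneg _ _ hPpos.le, mul_one]
  rw [hmm, Finset.sum_congr rfl fun i _ => hM i, ← Finset.mul_sum, hQ]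
  -- Since `u ≥ 1 + log u`, `(1 - u)² = 1 + L - 2 u ≤ L - 1 - log L`, and `log L` is bounded below
  -- by `hsum`.
  have h4 : (1 - u) ^ 2 / l ≤ (L - 1 - ∑ i, d i + 3 * Fintype.card ι * D ^ 2) / l := by
    refine div_le_div_of_nonneg_right ?_ hl.le
    nlinarith
  have h5 : (1 - l) * P - (P * L - P - P * ∑ i, d i + 3 * Fintype.card ι * D ^ 2 * P) / l =
      P * (1 - l - (L - 1 - ∑ i, d i + 3 * Fintype.card ι * D ^ 2) / l) := by ring
  rw [h5]
  exact mul_le_mul_of_nonneg_left (by linarith) hPpos.le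

/-- If no user's factor vanishes identically, some sample vector has a positive product. The
inequality keeps the product positive under any change of one sample, so all factors are positive
and the other users' factors cancel. -/
theorem forall_eq_zero_or_forall_pos {ι κ : Type*} [Fintype ι] [DecidableEq ι] {f : ι → κ → ℝ≥0}
    {E : ℝ≥0} (h : ∀ (x : ι → κ) (i : ι) (y : κ),
      ∏ j, f j (x j) ≤ E * ∏ j, f j (Function.update x i y j)) :
    (∃ i, ∀ x, f i x = 0) ∨ (∀ i x, 0 < f i x) ∧ ∀ i x y, f i x ≤ E * f i y := by
  by_cases h0 : ∃ i, ∀ x, f i x = 0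
  · exact Or.inl h0
  right
  push Not at h0
  choose x hx using h0
  have hpos : ∀ i y, 0 < f i y := by
    intro i y
    have h1 := h x i y
    have h2 : 0 < ∏ j, f j (x j) := Finset.prod_pos fun j _ => pos_iff_ne_zero.2 (hx j)
    have h3 : ∏ j, f j (Function.update x i y j) ≠ 0 := by
      intro h3
      rw [h3, mul_zero] at h1
      exact absurd h1 (not_le.2 h2)
    have := Finset.prod_ne_zero_iff.1 h3 i (Finset.mem_univ i)
    rw [Function.update_self] at this
    exact pos_iff_ne_zero.2 this
  refine ⟨hpos, fun i y z => ?_⟩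
  have h1 := h (Function.update x i y) i z
  rw [Function.update_idem, ← Finset.mul_prod_erase _ _ (Finset.mem_univ i),
    ← Finset.mul_prod_erase _ (fun j => f j (Function.update x i z j)) (Finset.mem_univ i),
    Function.update_self, Function.update_self, ← mul_assoc] at h1
  have h2 : ∀ w : κ, ∏ j ∈ Finset.univ.erase i, f j (Function.update x i w j) =
      ∏ j ∈ Finset.univ.erase i, f j (x j) := fun w =>
    Finset.prod_congr rfl fun j hj => by rw [Function.update_of_ne (Finset.ne_of_mem_erase hj)]
  rw [h2, h2] at h1
  exact le_of_mul_le_mul_right h1 (Finset.prod_pos fun j _ => hpos j _)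

/-- All values lie between the minimum of `f` and `E` times it, and the minimum is at most any
weighted mean. -/
theorem abs_sub_le_mul_sum {κ : Type*} [Fintype κ] {f : κ → ℝ} {E : ℝ} (hE : 1 ≤ E)
    (h : ∀ x y, f x ≤ E * f y) {w : κ → ℝ} (hw : w ∈ stdSimplex ℝ κ) (p q : κ) :
    |f p - f q| ≤ (E - 1) * ∑ x, w x * f x := by
  obtain ⟨z, -, hz⟩ := Finset.exists_min_image Finset.univ f ⟨p, Finset.mem_univ p⟩
  have hle : f z ≤ ∑ x, w x * f x := by
    calc f z = ∑ x, w x * f z := by rw [← Finset.sum_mul, hw.2, one_mul]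
      _ ≤ _ := Finset.sum_le_sum fun x _ =>
        mul_le_mul_of_nonneg_left (hz x (Finset.mem_univ x)) (hw.1 x)
  refine le_trans ?_ (mul_le_mul_of_nonneg_left hle (by linarith))
  rw [abs_le]
  constructor <;>
    linarith [h p z, h q z, hz p (Finset.mem_univ p), hz q (Finset.mem_univ q)]

theorem sum_mul_le_mul_sum {κ : Type*} [Fintype κ] {f : κ → ℝ} {E : ℝ}
    (h : ∀ x y, f x ≤ E * f y) {w w' : κ → ℝ} (hw : w ∈ stdSimplex ℝ κ)
    (hw' : w' ∈ stdSimplex ℝ κ) : ∑ x, w x * f x ≤ E * ∑ x, w' x * f x := by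
  calc ∑ x, w x * f x = ∑ y, w' y * ∑ x, w x * f x := by rw [← Finset.sum_mul, hw'.2, one_mul]
    _ ≤ ∑ y, w' y * (E * f y) := by
      refine Finset.sum_le_sum fun y _ => mul_le_mul_of_nonneg_left ?_ (hw'.1 y)
      calc ∑ x, w x * f x ≤ ∑ x, w x * (E * f y) :=
            Finset.sum_le_sum fun x _ => mul_le_mul_of_nonneg_left (h x y) (hw.1 x)
        _ = E * f y := by rw [← Finset.sum_mul, hw.2, one_mul]
    _ = _ := by rw [Finset.mul_sum]; exact Finset.sum_congr rfl fun y _ => by ring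

/-! ### Overlap of the transcript laws under two sample distributions -/

section Mixture

variable {n k : ℕ} {T : Type*}

/-- The density of the transcript when the sample of user `i` has the law `w i`, given the factors
`f i x` of the densities for fixed samples. -/
def mixDensity (f : Fin n → Fin k → T → ℝ≥0) (w : Fin n → Fin k → ℝ) (t : T) : ℝ :=
  ∏ i, ∑ x, w i x * f i x t

theorem mixDensity_eq_sum (f : Fin n → Fin k → T → ℝ≥0) (w : Fin n → Fin k → ℝ) (t : T) :
    mixDensity f w t = ∑ x : Fin n → Fin k, (∏ i, w i (x i)) * ∏ i, (f i (x i) t : ℝ) := by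
  classical
  simp only [mixDensity, Finset.prod_univ_sum, Fintype.piFinset_univ, Finset.prod_mul_distrib]

theorem mixDensity_nonneg (f : Fin n → Fin k → T → ℝ≥0) {w : Fin n → Fin k → ℝ}
    (hw : ∀ i x, 0 ≤ w i x) (t : T) : 0 ≤ mixDensity f w t :=
  Finset.prod_nonneg fun i _ => Finset.sum_nonneg fun x _ => mul_nonneg (hw i x) (f i x t).2

variable [MeasurableSpace T] {ν : Measure T} {f : Fin n → Fin k → T → ℝ≥0}

theorem hasIntegral_prod (hf : ∀ i x, Measurable (f i x)) {x : Fin n → Fin k}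
    (h1 : ∫⁻ t, ∏ i, (f i (x i) t : ℝ≥0∞) ∂ν = 1) :
    Integrable (fun t => ∏ i, (f i (x i) t : ℝ)) ν ∧ ∫ t, ∏ i, (f i (x i) t : ℝ) ∂ν = 1 := by
  have hm : Measurable fun t => ∏ i, (f i (x i) t : ℝ) :=
    Finset.measurable_fun_prod _ fun i _ => (hf i (x i)).coe_nnreal_real
  have hnn : ∀ t, 0 ≤ ∏ i, (f i (x i) t : ℝ) := fun t => Finset.prod_nonneg fun i _ => (f i _ t).2
  have heq : ∀ t, ENNReal.ofReal (∏ i, (f i (x i) t : ℝ)) = ∏ i, (f i (x i) t : ℝ≥0∞) := fun t => by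
    rw [ENNReal.ofReal_prod_of_nonneg fun i _ => NNReal.coe_nonneg _]
    simp
  have hl : ∫⁻ t, ENNReal.ofReal (∏ i, (f i (x i) t : ℝ)) ∂ν = 1 := by simp only [heq, h1]
  refine ⟨⟨hm.aestronglyMeasurable, ?_⟩, ?_⟩
  · rw [hasFiniteIntegral_iff_ofReal (Filter.Eventually.of_forall hnn), hl]
    exact ENNReal.one_lt_top
  · rw [integral_eq_lintegral_of_nonneg_ae (Filter.Eventually.of_forall hnn)
      hm.aestronglyMeasurable, hl, ENNReal.toReal_one]

theorem integrable_mixDensity (hf : ∀ i x, Measurable (f i x))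
    (h1 : ∀ x : Fin n → Fin k, ∫⁻ t, ∏ i, (f i (x i) t : ℝ≥0∞) ∂ν = 1) (w : Fin n → Fin k → ℝ) :
    Integrable (mixDensity f w) ν := by
  simp only [funext (mixDensity_eq_sum f w)]
  exact integrable_finsetSum _ fun x _ => (hasIntegral_prod hf (h1 x)).1.const_mul _

theorem integral_mixDensity (hf : ∀ i x, Measurable (f i x))
    (h1 : ∀ x : Fin n → Fin k, ∫⁻ t, ∏ i, (f i (x i) t : ℝ≥0∞) ∂ν = 1) {w : Fin n → Fin k → ℝ}
    (hw : ∀ i, ∑ x, w i x = 1) : ∫ t, mixDensity f w t ∂ν = 1 := by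
  classical
  simp only [mixDensity_eq_sum]
  rw [integral_finsetSum _ fun x _ => (hasIntegral_prod hf (h1 x)).1.const_mul _]
  simp only [integral_const_mul, (hasIntegral_prod hf (h1 _)).2, mul_one]
  have := Finset.prod_univ_sum (fun _ : Fin n => (Finset.univ : Finset (Fin k))) w
  rw [Fintype.piFinset_univ] at this
  rw [← this]
  simp [hw]

/-- If changing the sample of one user changes the density of the transcript by a factor at most `E`,
then moving a mass `c` between two points in the law of the samples changes the law of the transcript
little. -/
theorem three_fourths_le_integral_min (hf : ∀ i x, Measurable (f i x))
    (h1 : ∀ x : Fin n → Fin k, ∫⁻ t, ∏ i, (f i (x i) t : ℝ≥0∞) ∂ν = 1)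
    {E : ℝ≥0} (hE1 : 1 ≤ E) (hE3 : E ≤ 3)
    (hE : ∀ᵐ t ∂ν, ∀ (x : Fin n → Fin k) (i : Fin n) (y : Fin k),
      ∏ j, f j (x j) t ≤ E * ∏ j, f j (Function.update x i y j) t)
    {p q : Fin k → ℝ} (hp : p ∈ stdSimplex ℝ (Fin k)) (hq : q ∈ stdSimplex ℝ (Fin k))
    {c : ℝ} {a b : Fin k}
    (hpq : ∀ g : Fin k → ℝ, ∑ x, q x * g x - ∑ x, p x * g x = c * (g a - g b))
    (hc : 192 * n * (|c| * (E - 1)) ^ 2 ≤ 1) :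
    3 / 4 ≤ ∫ t, min (mixDensity f (fun _ => p) t) (mixDensity f (fun _ => q) t) ∂ν := by
  set P := mixDensity f fun _ => p with hPdef
  set Q := mixDensity f fun _ => q with hQdef
  set M : Fin n → T → ℝ := fun i => mixDensity f (Function.update (fun _ => p) i q) with hMdef
  have hiP : Integrable P ν := integrable_mixDensity hf h1 _
  have hiQ : Integrable Q ν := integrable_mixDensity hf h1 _
  have hiM : ∀ i, Integrable (M i) ν := fun i => integrable_mixDensity hf h1 _
  have hIP : ∫ t, P t ∂ν = 1 := integral_mixDensity hf h1 fun _ => hp.2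
  have hIQ : ∫ t, Q t ∂ν = 1 := integral_mixDensity hf h1 fun _ => hq.2
  have hIM : ∀ i, ∫ t, M i t ∂ν = 1 := fun i => integral_mixDensity hf h1 fun j => by
    by_cases hj : j = i
    · subst hj; simpa using hq.2
    · simpa [hj] using hp.2
  set D : ℝ := |c| * (E - 1) with hD
  have hEr : (1 : ℝ) ≤ E := by exact_mod_cast hE1
  have hEr3 : (E : ℝ) ≤ 3 := by exact_mod_cast hE3
  -- `le_min_prod` with `l = 1 / 8`: after integration the loss is `1 / 8 + 24 n D²`, and `hc` makes
  -- the second term at most `1 / 8`.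
  have hpt : ∀ᵐ t ∂ν, (1 - 1 / 8) * P t - (Q t - P t - ∑ i, (M i t - P t)
      + 3 * n * D ^ 2 * P t) / (1 / 8) ≤ min (P t) (Q t) := by
    filter_upwards [hE] with t ht
    have hMt : ∀ i, M i t = ∏ j, Function.update (fun j => ∑ x, p x * (f j x t : ℝ)) i
        (∑ x, q x * (f i x t : ℝ)) j := fun i => by
      refine Finset.prod_congr rfl fun j _ => ?_
      by_cases hj : j = i
      · subst hj; simp
      · simp [hj]
    -- If one user's factor vanishes at `t`, so do `P`, `Q` and every `M i`, and the inequality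
    -- reads `0 ≤ 0`.
    rcases forall_eq_zero_or_forall_pos (f := fun i x => f i x t) ht with ⟨i, hi⟩ | ⟨hpos, hrat⟩
    · have h0 : ∀ w : Fin n → Fin k → ℝ, mixDensity f w t = 0 := fun w =>
        Finset.prod_eq_zero (Finset.mem_univ i) (by simp [hi])
      simp [hPdef, hQdef, hMdef, h0]
    · have hrat' : ∀ i x y, (f i x t : ℝ) ≤ E * f i y t := fun i x y => by
        exact_mod_cast hrat i x y
      have := le_min_prod (a := fun i => ∑ x, p x * (f i x t : ℝ))
        (b := fun i => ∑ x, q x * (f i x t : ℝ)) (D := D) (l := 1 / 8) ?_ ?_ ?_ (by norm_num)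
      · simp only [Fintype.card_fin, ← hMt] at this
        exact this
      · intro i
        have : (f i a t : ℝ) ≤ E * ∑ x, p x * (f i x t : ℝ) := by
          rw [Finset.mul_sum]
          calc (f i a t : ℝ) = ∑ x, p x * (f i a t : ℝ) := by rw [← Finset.sum_mul, hp.2, one_mul]
            _ ≤ _ := Finset.sum_le_sum fun x _ => by
              have := mul_le_mul_of_nonneg_left (hrat' i a x) (hp.1 x)
              linarith
        have h2 : (0 : ℝ) < f i a t := by exact_mod_cast hpos i a
        exact pos_of_mul_pos_right (lt_of_lt_of_le h2 this) (by linarith)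
      · intro i
        rw [hpq fun x => (f i x t : ℝ), abs_mul, hD, mul_assoc]
        exact mul_le_mul_of_nonneg_left (abs_sub_le_mul_sum hEr (hrat' i) hp a b) (abs_nonneg c)
      · intro i
        refine (sum_mul_le_mul_sum (hrat' i) hp hq).trans ?_
        exact mul_le_mul_of_nonneg_right hEr3 (Finset.sum_nonneg fun x _ =>
          mul_nonneg (hq.1 x) (f i x t).2)
  have hiS : Integrable (fun t => ∑ i, (M i t - P t)) ν :=
    integrable_finsetSum _ fun i _ => (hiM i).sub hiP
  have hmono := integral_mono_ae (((hiP.const_mul (1 - 1 / 8 : ℝ)).sub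
    ((((hiQ.sub hiP).sub hiS).add (hiP.const_mul (3 * n * D ^ 2))).div_const (1 / 8))))
    (hiP.inf hiQ) hpt
  refine le_trans ?_ hmono
  rw [integral_sub' (hiP.const_mul (1 - 1 / 8 : ℝ))
    ((((hiQ.sub hiP).sub hiS).add (hiP.const_mul (3 * n * D ^ 2))).div_const (1 / 8)),
    integral_div, integral_add' ((hiQ.sub hiP).sub hiS) (hiP.const_mul (3 * n * D ^ 2)),
    integral_sub' (hiQ.sub hiP) hiS, integral_sub' hiQ hiP,
    integral_finsetSum (f := fun i t => M i t - P t) _ fun i _ => (hiM i).sub hiP, integral_const_mul, integral_const_mul]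
  -- All these densities have integral one, so the zeroth- and first-order terms cancel.
  simp only [integral_sub (hiM _) hiP, hIP, hIQ, hIM]
  simp only [sub_self, Finset.sum_const_zero]
  linarith

end Mixture

/-! ### Risk and privacy in terms of densities -/

theorem Protocol.lintegral_lawUnder {k n : ℕ} (A : Protocol k n)
    {ν : Measure (Fin A.rounds → A.Msg)} {f : Fin n → Fin k → (Fin A.rounds → A.Msg) → ℝ≥0}
    (hf : ∀ i x, Measurable (f i x))
    (hlaw : ∀ x, A.law x = ν.withDensity (fun t => ∏ i, (f i (x i) t : ℝ≥0∞)))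
    {p : Fin k → ℝ} (hp : ∀ x, 0 ≤ p x) {g : (Fin A.rounds → A.Msg) → ℝ≥0∞} (hg : Measurable g) :
    ∫⁻ t, g t ∂(A.lawUnder p) =
      ∫⁻ t, ENNReal.ofReal (mixDensity f (fun _ => p) t) * g t ∂ν := by
  have hF : ∀ x : Fin n → Fin k, Measurable fun t => ∏ i, (f i (x i) t : ℝ≥0∞) := fun x =>
    Finset.measurable_fun_prod _ fun i _ => (hf i (x i)).coe_nnreal_ennreal
  have h1 : ∀ t, ENNReal.ofReal (mixDensity f (fun _ => p) t) * g t =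
      ∑ x : Fin n → Fin k, (∏ i, ENNReal.ofReal (p (x i))) *
        ((∏ i, (f i (x i) t : ℝ≥0∞)) * g t) := fun t => by
    rw [mixDensity_eq_sum, ENNReal.ofReal_sum_of_nonneg, Finset.sum_mul]
    · refine Finset.sum_congr rfl fun x _ => ?_
      rw [ENNReal.ofReal_mul (Finset.prod_nonneg fun i _ => hp _),
        ENNReal.ofReal_prod_of_nonneg fun i _ => hp _,
        ENNReal.ofReal_prod_of_nonneg fun i _ => NNReal.coe_nonneg _, mul_assoc]
      simp
    · exact fun x _ => mul_nonneg (Finset.prod_nonneg fun i _ => hp _)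
        (Finset.prod_nonneg fun i _ => NNReal.coe_nonneg _)
  simp only [h1, Protocol.lawUnder]
  rw [lintegral_finsetSum (f := fun (x : Fin n → Fin k) t => (∏ i, ENNReal.ofReal (p (x i))) *
      ((∏ i, (f i (x i) t : ℝ≥0∞)) * g t)) _ fun x _ => ((hF x).mul hg).const_mul _, lintegral_finsetSum_measure]
  refine Finset.sum_congr rfl fun x _ => ?_
  rw [lintegral_smul_measure, lintegral_const_mul (f := fun t => (∏ i, (f i (x i) t : ℝ≥0∞)) * g t) _
    ((hF x).mul hg), hlaw,
    lintegral_withDensity_eq_lintegral_mul _ (hF x) hg]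
  rfl

/-- Inequalities between measures of all measurable sets become almost-everywhere inequalities of
densities; there are finitely many triples `(x, i, y)`, so one null set suffices. -/
theorem Protocol.IsLDP.ae_density_le {k n : ℕ} {A : Protocol k n} {α : ℝ} (h : A.IsLDP α 0)
    {ν : Measure (Fin A.rounds → A.Msg)} [IsFiniteMeasure ν]
    {f : Fin n → Fin k → (Fin A.rounds → A.Msg) → ℝ≥0} (hf : ∀ i x, Measurable (f i x))
    (hlaw : ∀ x, A.law x = ν.withDensity (fun t => ∏ i, (f i (x i) t : ℝ≥0∞))) :
    ∀ᵐ t ∂ν, ∀ (x : Fin n → Fin k) (i : Fin n) (y : Fin k),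
      ∏ j, f j (x j) t ≤ (Real.exp α).toNNReal * ∏ j, f j (Function.update x i y j) t := by
  have hF : ∀ x : Fin n → Fin k, Measurable fun t => ∏ i, (f i (x i) t : ℝ≥0∞) := fun x =>
    Finset.measurable_fun_prod _ fun i _ => (hf i (x i)).coe_nnreal_ennreal
  simp only [ae_all_iff]
  intro x i y
  have hle := ae_le_of_forall_setLIntegral_le_of_sigmaFinite (μ := ν) (hF x)
    (g := fun t => ENNReal.ofReal (Real.exp α) * ∏ j, (f j (Function.update x i y j) t : ℝ≥0∞))
    (fun s hs _ => by
      rw [lintegral_const_mul _ (hF _), ← withDensity_apply _ hs, ← withDensity_apply _ hs,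
        ← hlaw, ← hlaw]
      simpa using h x i y s hs)
  filter_upwards [hle] with t ht
  have h2 : ((∏ j, f j (x j) t : ℝ≥0) : ℝ≥0∞) ≤
      (((Real.exp α).toNNReal * ∏ j, f j (Function.update x i y j) t : ℝ≥0) : ℝ≥0∞) := by
    push_cast
    exact ht
  exact_mod_cast h2

/-- Le Cam's two-point argument: `P g + Q h ≥ min P Q * (g + h)`. Two losses that cannot both be
small cost at least `δ` times the overlap. -/
theorem ofReal_le_lintegral_add_lintegral {T : Type*} [MeasurableSpace T] {ν : Measure T}
    {P Q : T → ℝ} (hP : Integrable P ν) (hQ : Integrable Q ν) (hP0 : ∀ t, 0 ≤ P t)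
    (hQ0 : ∀ t, 0 ≤ Q t) {s : ℝ} (hs : s ≤ ∫ t, min (P t) (Q t) ∂ν)
    (hPm : Measurable P) {g h : T → ℝ≥0∞} (hg : Measurable g) {δ : ℝ} (hδ : 0 ≤ δ)
    (hgh : ∀ t, ENNReal.ofReal δ ≤ g t + h t) :
    ENNReal.ofReal (s * δ) ≤
      ∫⁻ t, ENNReal.ofReal (P t) * g t ∂ν + ∫⁻ t, ENNReal.ofReal (Q t) * h t ∂ν := by
  have hmin : Integrable (fun t => min (P t) (Q t)) ν := hP.inf hQ
  rw [← lintegral_add_left (f := fun t => ENNReal.ofReal (P t) * g t) (hPm.ennreal_ofReal.mul hg)]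
  calc ENNReal.ofReal (s * δ) ≤ ENNReal.ofReal (∫ t, min (P t) (Q t) * δ ∂ν) := by
        rw [integral_mul_const]
        exact ENNReal.ofReal_le_ofReal (mul_le_mul_of_nonneg_right hs hδ)
    _ = ∫⁻ t, ENNReal.ofReal (min (P t) (Q t) * δ) ∂ν :=
        ofReal_integral_eq_lintegral_ofReal (hmin.mul_const δ)
          (Filter.Eventually.of_forall fun t => mul_nonneg (le_min (hP0 t) (hQ0 t)) hδ)
    _ ≤ _ := lintegral_mono fun t => by
        simp only
        rw [ENNReal.ofReal_mul (le_min (hP0 t) (hQ0 t))]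
        refine (mul_le_mul_right (hgh t) _).trans ?_
        rw [mul_add]
        gcongr
        · exact min_le_left _ _
        · exact min_le_right _ _

/-! ### Assouad's hypercube -/

section Cube

variable {m k : ℕ}

/-- The weight of the vertex `v` of the hypercube on `Fin m × Bool`: the mass of each of the `m` pairs
is `1 / m`, and `v` says which point of the pair is the heavier. -/
noncomputable def cubeWeight (γ : ℝ) (v : Fin m → Bool) (z : Fin m × Bool) : ℝ :=
  (1 + γ * if v z.1 = z.2 then 1 else -1) / (2 * m)

/-- The distribution on `Fin k` with the weights `cubeWeight`. -/
noncomputable def cubePoint (γ : ℝ) (e : Fin m × Bool ↪ Fin k) (v : Fin m → Bool) (x : Fin k) : ℝ :=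
  ∑ z, if e z = x then cubeWeight γ v z else 0

theorem sum_cubePoint_mul (γ : ℝ) (e : Fin m × Bool ↪ Fin k) (v : Fin m → Bool) (g : Fin k → ℝ) :
    ∑ x, cubePoint γ e v x * g x = ∑ z, cubeWeight γ v z * g (e z) := by
  simp only [cubePoint, Finset.sum_mul]
  rw [Finset.sum_comm]
  refine Finset.sum_congr rfl fun z _ => ?_
  simp [ite_mul]

theorem cubePoint_apply (γ : ℝ) (e : Fin m × Bool ↪ Fin k) (v : Fin m → Bool) (z : Fin m × Bool) :
    cubePoint γ e v (e z) = cubeWeight γ v z := by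
  simp [cubePoint]

theorem cubeWeight_nonneg {γ : ℝ} (h0 : 0 ≤ γ) (h1 : γ ≤ 1) (v : Fin m → Bool)
    (z : Fin m × Bool) : 0 ≤ cubeWeight γ v z := by
  unfold cubeWeight
  refine div_nonneg ?_ (by positivity)
  split_ifs <;> linarith

theorem cubePoint_mem_stdSimplex {γ : ℝ} (h0 : 0 ≤ γ) (h1 : γ ≤ 1) (hm : 0 < m)
    (e : Fin m × Bool ↪ Fin k) (v : Fin m → Bool) : cubePoint γ e v ∈ stdSimplex ℝ (Fin k) := by
  refine ⟨fun x => Finset.sum_nonneg fun z _ => ?_, ?_⟩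
  · split_ifs
    · exact cubeWeight_nonneg h0 h1 v z
    · exact le_rfl
  · have := sum_cubePoint_mul γ e v fun _ => 1
    simp only [mul_one] at this
    have h2 : ∀ j : Fin m, ∑ b, cubeWeight γ v (j, b) = 1 / m := fun j => by
      have hm' : (m : ℝ) ≠ 0 := by positivity
      rw [Fintype.sum_bool]
      unfold cubeWeight
      cases v j <;> simp <;> field_simp <;> ring
    have hm' : (m : ℝ) ≠ 0 := by positivity
    rw [this, Fintype.sum_prod_type, Finset.sum_congr rfl fun j _ => h2 j]
    simp [hm']

/-- Flipping the coordinate `j` of a vertex of the hypercube. -/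
def flip (j : Fin m) (v : Fin m → Bool) : Fin m → Bool := Function.update v j (!v j)

theorem flip_involutive (j : Fin m) : Function.Involutive (flip j) := fun v => by
  simp [flip]

theorem cubeWeight_flip_sub (γ : ℝ) (j : Fin m) (v : Fin m → Bool) (b : Bool) :
    cubeWeight γ (flip j v) (j, b) - cubeWeight γ v (j, b) =
      if v j = b then -(γ / m) else γ / m := by
  unfold cubeWeight flip
  rw [Function.update_self]
  cases v j <;> cases b <;> simp <;> ring

theorem cubeWeight_flip_of_ne (γ : ℝ) {j i : Fin m} (hij : i ≠ j) (v : Fin m → Bool) (b : Bool) :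
    cubeWeight γ (flip j v) (i, b) = cubeWeight γ v (i, b) := by
  unfold cubeWeight flip
  rw [Function.update_of_ne hij]

theorem sum_cubePoint_flip_sub (γ : ℝ) (e : Fin m × Bool ↪ Fin k) (v : Fin m → Bool) (j : Fin m)
    (g : Fin k → ℝ) :
    ∑ x, cubePoint γ e (flip j v) x * g x - ∑ x, cubePoint γ e v x * g x =
      (γ / m) * (g (e (j, !v j)) - g (e (j, v j))) := by
  rw [sum_cubePoint_mul, sum_cubePoint_mul, ← Finset.sum_sub_distrib, Fintype.sum_prod_type,
    Finset.sum_eq_single j]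
  · simp only [← sub_mul, cubeWeight_flip_sub]
    rw [Fintype.sum_bool]
    cases v j <;> simp <;> ring
  · intro i _ hi
    simp [cubeWeight_flip_of_ne γ hi]
  · simp

/-- The part of the `ℓ₁` error of the estimate `y` at the pair `j`. -/
noncomputable def pairLoss (γ : ℝ) (e : Fin m × Bool ↪ Fin k) (v : Fin m → Bool) (j : Fin m)
    (y : Fin k → ℝ) : ℝ :=
  ∑ b, |y (e (j, b)) - cubeWeight γ v (j, b)|

theorem pairLoss_nonneg (γ : ℝ) (e : Fin m × Bool ↪ Fin k) (v : Fin m → Bool) (j : Fin m)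
    (y : Fin k → ℝ) : 0 ≤ pairLoss γ e v j y :=
  Finset.sum_nonneg fun _ _ => abs_nonneg _

theorem sum_pairLoss_le (γ : ℝ) (e : Fin m × Bool ↪ Fin k) (v : Fin m → Bool) (y : Fin k → ℝ) :
    ∑ j, pairLoss γ e v j y ≤ ∑ x, |y x - cubePoint γ e v x| := by
  unfold pairLoss
  rw [← Fintype.sum_prod_type (f := fun z : Fin m × Bool => |y (e z) - cubeWeight γ v z|)]
  simp only [← cubePoint_apply γ e]
  rw [← Finset.sum_map Finset.univ e fun x => |y x - cubePoint γ e v x|]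
  exact Finset.sum_le_sum_of_subset_of_nonneg (Finset.subset_univ _) fun _ _ _ => abs_nonneg _

/-- Flipping changes both points of the pair by `γ / m`, and the triangle inequality applies at
each. -/
theorem le_pairLoss_add_pairLoss_flip {γ : ℝ} (h0 : 0 ≤ γ) (e : Fin m × Bool ↪ Fin k)
    (v : Fin m → Bool) (j : Fin m) (y : Fin k → ℝ) :
    2 * γ / m ≤ pairLoss γ e v j y + pairLoss γ e (flip j v) j y := by
  unfold pairLoss
  rw [← Finset.sum_add_distrib]
  have : ∀ b, γ / m ≤ |y (e (j, b)) - cubeWeight γ v (j, b)| +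
      |y (e (j, b)) - cubeWeight γ (flip j v) (j, b)| := fun b => by
    have h1 := cubeWeight_flip_sub γ j v b
    have h2 : |cubeWeight γ (flip j v) (j, b) - cubeWeight γ v (j, b)| = γ / m := by
      rw [h1]
      split_ifs <;> simp [abs_of_nonneg h0, abs_div]
    rw [← h2]
    have := abs_sub (y (e (j, b)) - cubeWeight γ v (j, b))
      (y (e (j, b)) - cubeWeight γ (flip j v) (j, b))
    rwa [sub_sub_sub_cancel_left] at this
  rw [Fintype.sum_bool]
  have h3 : 2 * γ / m = γ / m + γ / m := by ring
  rw [h3]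
  exact add_le_add (this true) (this false)

end Cube

/-- **Assouad's bound** for locally private estimators: the worst-case risk is at least `3 γ / 4` as
long as the distributions with the perturbation `γ` cannot be told apart. -/
theorem Protocol.IsLDP.le_worstRisk {k n m : ℕ} {B : Protocol k n} {α γ : ℝ} (hB : B.IsLDP α 0)
    (hα0 : 0 < α) (hα1 : α < 1) (hγ0 : 0 ≤ γ) (hγ1 : γ ≤ 1) (hm : 0 < m)
    (e : Fin m × Bool ↪ Fin k) (hn : 768 * n * (γ * α) ^ 2 ≤ (m : ℝ) ^ 2) :
    ENNReal.ofReal (3 / 4 * γ) ≤ B.worstRisk := by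
  obtain ⟨ν, hν, f, hf, hlaw⟩ := B.exists_density B.rounds
  change ∀ x, B.law x = _ at hlaw
  have hm' : (0 : ℝ) < m := by exact_mod_cast hm
  have h1 : ∀ x : Fin n → Fin k, ∫⁻ t, ∏ i, (f i (x i) t : ℝ≥0∞) ∂ν = 1 := fun x => by
    have : IsProbabilityMeasure (B.law x) := B.isProbabilityMeasure_lawUpTo x _
    have h2 := measure_univ (μ := B.law x)
    rwa [hlaw, withDensity_apply _ MeasurableSet.univ, Measure.restrict_univ] at h2
  have hlow : 1 ≤ Real.exp α := Real.one_le_exp hα0.le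
  have hupp : Real.exp α ≤ 3 :=
    (Real.exp_le_exp.2 hα1.le).trans (Real.exp_one_lt_d9.le.trans (by norm_num))
  -- The square of this factor `2` turns the constant `192` of the overlap bound into `768`.
  have hsub : Real.exp α - 1 ≤ 2 * α := by
    have := Real.abs_exp_sub_one_le (x := α) (by rw [abs_of_pos hα0]; exact hα1.le)
    rw [abs_of_pos hα0] at this
    exact (le_abs_self _).trans this
  have hcoe : ((Real.exp α).toNNReal : ℝ) = Real.exp α := Real.coe_toNNReal _ (Real.exp_pos α).le
  set p := cubePoint γ e with hp
  have hpS : ∀ v, p v ∈ stdSimplex ℝ (Fin k) := cubePoint_mem_stdSimplex hγ0 hγ1 hm e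
  set P : (Fin m → Bool) → (Fin B.rounds → B.Msg) → ℝ := fun v => mixDensity f fun _ => p v with hP
  have hPm : ∀ v, Measurable (P v) := fun v => by
    simp only [hP]
    unfold mixDensity
    exact Finset.measurable_fun_prod _ fun i _ => Finset.measurable_fun_sum _ fun x _ =>
      (hf i x).coe_nnreal_real.const_mul _
  have hℓm : ∀ v j, Measurable fun t => ENNReal.ofReal (pairLoss γ e v j (B.est t)) := fun v j => by
    refine Measurable.ennreal_ofReal ?_
    unfold pairLoss
    refine Finset.measurable_fun_sum _ fun b _ => ?_
    exact (((measurable_pi_apply _).comp B.measurable_est).sub_const _).abs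
  set R : Fin m → (Fin m → Bool) → ℝ≥0∞ := fun j v =>
    ∫⁻ t, ENNReal.ofReal (P v t) * ENNReal.ofReal (pairLoss γ e v j (B.est t)) ∂ν with hR
  have hpair : ∀ j v, ENNReal.ofReal (3 / 4 * (2 * γ / m)) ≤ R j v + R j (flip j v) := fun j v => by
    refine ofReal_le_lintegral_add_lintegral (integrable_mixDensity hf h1 _)
      (integrable_mixDensity hf h1 _) (mixDensity_nonneg f fun _ => (hpS v).1)
      (mixDensity_nonneg f fun _ => (hpS _).1) ?_ (hPm v) (hℓm v j) (by positivity) fun t => ?_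
    · refine three_fourths_le_integral_min hf h1 (E := (Real.exp α).toNNReal) ?_ ?_
        (hB.ae_density_le hf hlaw) (hpS v) (hpS _) (sum_cubePoint_flip_sub γ e v j) ?_
      · rw [← NNReal.coe_le_coe, hcoe]; exact hlow
      · rw [← NNReal.coe_le_coe, hcoe]; exact hupp
      · rw [hcoe, abs_of_nonneg (by positivity)]
        have h3 : (γ / m * (Real.exp α - 1)) ^ 2 ≤ (γ / m * (2 * α)) ^ 2 := by
          have : 0 ≤ Real.exp α - 1 := by linarith
          gcongr
        calc 192 * (n : ℝ) * (γ / m * (Real.exp α - 1)) ^ 2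
            ≤ 192 * n * (γ / m * (2 * α)) ^ 2 := by gcongr
          _ = 768 * n * (γ * α) ^ 2 / (m : ℝ) ^ 2 := by field_simp; ring
          _ ≤ 1 := by rw [div_le_one (by positivity)]; exact hn
    · rw [← ENNReal.ofReal_add (pairLoss_nonneg ..) (pairLoss_nonneg ..)]
      exact ENNReal.ofReal_le_ofReal (le_pairLoss_add_pairLoss_flip hγ0 e v j _)
  have hrisk : ∀ v, ∑ j, R j v ≤ B.worstRisk := fun v => by
    refine le_trans ?_ (le_iSup₂ (f := fun p (_ : p ∈ stdSimplex ℝ (Fin k)) => B.risk p)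
      (p v) (hpS v))
    unfold Protocol.risk
    rw [B.lintegral_lawUnder hf hlaw (hpS v).1, hR,
      ← lintegral_finsetSum (f := fun j t => ENNReal.ofReal (P v t) *
        ENNReal.ofReal (pairLoss γ e v j (B.est t))) _ fun j _ => (hPm v).ennreal_ofReal.mul (hℓm v j)]
    · refine lintegral_mono fun t => ?_
      simp only
      rw [← Finset.mul_sum, ← ENNReal.ofReal_sum_of_nonneg fun j _ => pairLoss_nonneg ..]
      exact mul_le_mul_right (ENNReal.ofReal_le_ofReal (sum_pairLoss_le γ e v _)) _
    · refine Measurable.ennreal_ofReal (Finset.measurable_fun_sum _ fun x _ => ?_)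
      exact (((measurable_pi_apply _).comp B.measurable_est).sub_const _).abs
  -- Flipping coordinate `j` permutes the vertices, so summing `hpair` over them counts each loss
  -- twice.
  have hj : ∀ j, (2 ^ m : ℝ≥0∞) * ENNReal.ofReal (3 / 4 * (2 * γ / m)) ≤ 2 * ∑ v, R j v := fun j => by
    have h4 : ∑ v, R j (flip j v) = ∑ v, R j v :=
      Equiv.sum_comp (flip_involutive j).toPerm (R j)
    rw [two_mul (∑ v, R j v)]
    nth_rw 2 [← h4]
    rw [← Finset.sum_add_distrib]
    calc (2 ^ m : ℝ≥0∞) * ENNReal.ofReal (3 / 4 * (2 * γ / m))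
        = ∑ v : Fin m → Bool, ENNReal.ofReal (3 / 4 * (2 * γ / m)) := by simp
      _ ≤ _ := Finset.sum_le_sum fun v _ => hpair j v
  have hall : (2 ^ m : ℝ≥0∞) * (2 * ENNReal.ofReal (3 / 4 * γ)) ≤ 2 ^ m * (2 * B.worstRisk) := by
    calc (2 ^ m : ℝ≥0∞) * (2 * ENNReal.ofReal (3 / 4 * γ))
        = ∑ j : Fin m, (2 ^ m : ℝ≥0∞) * ENNReal.ofReal (3 / 4 * (2 * γ / m)) := by
          rw [Finset.sum_const, Finset.card_univ, Fintype.card_fin, nsmul_eq_mul,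
            mul_left_comm (m : ℝ≥0∞)]
          congr 1
          rw [← ENNReal.ofReal_ofNat, ← ENNReal.ofReal_natCast m, ← ENNReal.ofReal_mul zero_le_two,
            ← ENNReal.ofReal_mul hm'.le]
          congr 1
          field_simp
      _ ≤ ∑ j, 2 * ∑ v, R j v := Finset.sum_le_sum fun j _ => hj j
      _ = 2 * ∑ v, ∑ j, R j v := by rw [← Finset.mul_sum, Finset.sum_comm]
      _ ≤ 2 * ∑ v : Fin m → Bool, B.worstRisk := by gcongr with v; exact hrisk v
      _ = 2 ^ m * (2 * B.worstRisk) := by simp; ring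
  have h5 := (ENNReal.mul_le_mul_iff_right (by simp) (by simp)).1 hall
  exact (ENNReal.mul_le_mul_iff_right (by simp) (by simp)).1 h5

/-! ### The transcript of `k`-RAPPOR and its privacy -/

theorem flipLaw_singleton (α : ℝ) (b d : Bool) :
    flipLaw α b {d} = if b = d then ENNReal.ofReal (Real.exp (α / 2) / (Real.exp (α / 2) + 1))
      else ENNReal.ofReal (1 / (Real.exp (α / 2) + 1)) := by
  unfold flipLaw
  cases b <;> cases d <;> simp

theorem flipLaw_singleton_le {α : ℝ} (hα : 0 ≤ α) (b b' d : Bool) :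
    flipLaw α b {d} ≤ ENNReal.ofReal (Real.exp (α / 2)) * flipLaw α b' {d} := by
  have he : 1 ≤ Real.exp (α / 2) := Real.one_le_exp (by linarith)
  have hp : 0 < Real.exp (α / 2) + 1 := by linarith
  rw [flipLaw_singleton, flipLaw_singleton]
  split_ifs <;> rw [← ENNReal.ofReal_mul (by positivity)] <;>
    refine ENNReal.ofReal_le_ofReal ?_ <;> rw [mul_div_assoc'] <;>
    refine div_le_div_of_nonneg_right ?_ hp.le <;> nlinarith

/-- The indicator vectors of `a` and `c` differ in at most the two bits `a` and `c`, and each costs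
a factor `e^(α/2)`. -/
theorem rapporMsg_singleton_le {α : ℝ} (hα : 0 ≤ α) {k : ℕ} (a c : Fin k) (b : Fin k → Bool) :
    rapporMsg α a {b} ≤ ENNReal.ofReal (Real.exp α) * rapporMsg α c {b} := by
  have hE : 1 ≤ ENNReal.ofReal (Real.exp (α / 2)) := by
    rw [ENNReal.one_le_ofReal]; exact Real.one_le_exp (by linarith)
  unfold rapporMsg
  rw [Measure.pi_singleton, Measure.pi_singleton]
  set E := ENNReal.ofReal (Real.exp (α / 2)) with hEdef
  have hEE : ENNReal.ofReal (Real.exp α) = E * E := by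
    rw [hEdef, ← ENNReal.ofReal_mul (Real.exp_pos _).le, ← Real.exp_add, add_halves]
  calc ∏ y, flipLaw α (decide (y = a)) {b y}
      ≤ ∏ y, (((if y = a then E else 1) * (if y = c then E else 1)) *
          flipLaw α (decide (y = c)) {b y}) := by
        refine Finset.prod_le_prod' fun y _ => ?_
        have h := flipLaw_singleton_le hα (decide (y = a)) (decide (y = c)) (b y)
        by_cases ha : y = a <;> by_cases hc : y = c
        · simp only [if_pos ha, if_pos hc]
          refine h.trans (mul_le_mul_left ?_ _)
          exact le_mul_of_one_le_right' hE
        · simpa only [if_pos ha, if_neg hc, mul_one] using h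
        · simpa only [if_neg ha, if_pos hc, one_mul] using h
        · simp [ha, hc]
    _ = _ := by
        rw [Finset.prod_mul_distrib, Finset.prod_mul_distrib, hEE]
        simp

theorem kRappor_lawUpTo (α : ℝ) (k n : ℕ) (x : Fin n → Fin k) (r : ℕ) (h : r ≤ n) :
    (kRappor α k n).lawUpTo x r =
      (Measure.pi fun i : Fin r => rapporMsg α (x (Fin.castLE h i)) :
        Measure (Fin r → Fin k → Bool)) := by
  induction r with
  | zero =>
    refine Eq.trans ?_ (Measure.pi_of_empty _ Fin.elim0).symm
    rfl
  | succ r ih =>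
    have hr : r < n := h
    have hs : (kRappor α k n).speaker r = some ⟨r, hr⟩ := dif_pos hr
    have hstep : (kRappor α k n).step r (((kRappor α k n).speaker r).map x) =
        Kernel.const (Fin r → Fin k → Bool) (rapporMsg α (x ⟨r, hr⟩)) := by
      rw [hs]; rfl
    have hrec : (kRappor α k n).lawUpTo x (r + 1) =
        (((Measure.pi fun i : Fin r => rapporMsg α (x (Fin.castLE hr.le i))).prod
          (rapporMsg α (x ⟨r, hr⟩))).map
          (fun hm => (Fin.snoc hm.1 hm.2 : Fin (r + 1) → Fin k → Bool)) :
          Measure (Fin (r + 1) → Fin k → Bool)) := by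
      rw [Protocol.lawUpTo, hstep, ih hr.le]
      rw [← Measure.compProd_const]
      rfl
    rw [hrec]
    refine Measure.ext_of_singleton fun t => ?_
    rw [Measure.map_apply (measurable_snoc r _) (measurableSet_singleton t)]
    have hpre : (fun hm : (Fin r → Fin k → Bool) × (Fin k → Bool) =>
        (Fin.snoc hm.1 hm.2 : Fin (r + 1) → Fin k → Bool)) ⁻¹' {t} =
        {fun i => t i.castSucc} ×ˢ {t (Fin.last r)} := by
      ext ⟨a, b⟩
      simp only [Set.mem_preimage, Set.mem_singleton_iff, Set.mem_prod]
      constructor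
      · rintro rfl
        exact ⟨by simp, by simp⟩
      · rintro ⟨rfl, rfl⟩
        exact Fin.snoc_init_self t
    rw [hpre, Measure.prod_prod, Measure.pi_singleton, Measure.pi_singleton, Fin.prod_univ_castSucc]
    rfl

theorem kRappor_law (α : ℝ) (k n : ℕ) (x : Fin n → Fin k) :
    (kRappor α k n).law x =
      (Measure.pi fun i : Fin n => rapporMsg α (x i) : Measure (Fin n → Fin k → Bool)) :=
  kRappor_lawUpTo α k n x n le_rfl

theorem measure_le_mul_of_singleton {T : Type*} [Finite T] [MeasurableSpace T]
    [MeasurableSingletonClass T] {μ ν : Measure T} {c : ℝ≥0∞} (h : ∀ t, μ {t} ≤ c * ν {t})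
    (s : Set T) : μ s ≤ c * ν s := by
  have hs := s.toFinite
  rw [← hs.coe_toFinset, ← sum_measure_singleton, ← sum_measure_singleton, Finset.mul_sum]
  exact Finset.sum_le_sum fun t _ => h t

theorem kRappor_isLDP {α : ℝ} (hα : 0 ≤ α) (k n : ℕ) : (kRappor α k n).IsLDP α 0 := by
  intro x i y O _
  rw [ENNReal.ofReal_zero, add_zero, kRappor_law, kRappor_law]
  refine measure_le_mul_of_singleton (T := Fin n → Fin k → Bool) (fun t => ?_) O
  rw [Measure.pi_singleton, Measure.pi_singleton, ← Finset.mul_prod_erase _ _ (Finset.mem_univ i),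
    ← Finset.mul_prod_erase _ (fun j => rapporMsg α (Function.update x i y j) {t j})
      (Finset.mem_univ i), Function.update_self, ← mul_assoc]
  refine mul_le_mul' (rapporMsg_singleton_le hα _ _ _) (Finset.prod_congr rfl fun j hj => ?_).le
  rw [Function.update_of_ne (Finset.ne_of_mem_erase hj)]

/-! ### Moments of the `k`-RAPPOR estimate -/

/-- The law of a message of a user whose sample is drawn from `p`. -/
noncomputable def rapporMix (α : ℝ) {k : ℕ} (p : Fin k → ℝ) : Measure (Fin k → Bool) :=
  ∑ x, ENNReal.ofReal (p x) • rapporMsg α x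

theorem isProbabilityMeasure_rapporMix (α : ℝ) {k : ℕ} {p : Fin k → ℝ}
    (hp : p ∈ stdSimplex ℝ (Fin k)) : IsProbabilityMeasure (rapporMix α p) := by
  constructor
  simp only [rapporMix, Measure.finsetSum_apply, Measure.smul_apply, measure_univ, smul_eq_mul,
    mul_one]
  rw [← ENNReal.ofReal_sum_of_nonneg fun x _ => hp.1 x, hp.2, ENNReal.ofReal_one]

/-- Messages are non-interactive and samples i.i.d., so the sum over sample vectors factors and the
messages are i.i.d. with law `rapporMix α p`. -/
theorem kRappor_lawUnder (α : ℝ) (k n : ℕ) {p : Fin k → ℝ} (hp : p ∈ stdSimplex ℝ (Fin k)) :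
    (kRappor α k n).lawUnder p =
      (Measure.pi fun _ : Fin n => rapporMix α p : Measure (Fin n → Fin k → Bool)) := by
  have := isProbabilityMeasure_rapporMix α hp
  unfold Protocol.lawUnder
  simp only [kRappor_law]
  refine Measure.ext_of_singleton (α := Fin n → Fin k → Bool) fun t => ?_
  rw [Measure.pi_singleton]
  refine (Measure.finsetSum_apply _ _ _).trans ?_
  simp only [rapporMix, Measure.finsetSum_apply, Measure.smul_apply, smul_eq_mul]
  rw [Finset.prod_univ_sum, Fintype.piFinset_univ]
  refine Finset.sum_congr rfl fun x _ => ?_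
  rw [Finset.prod_mul_distrib]
  rw [← Measure.pi_singleton (fun i => rapporMsg α (x i)) t]
  rfl

/-- The probability that a bit of a message is set if the corresponding element has mass `q`. -/
noncomputable def bitProb (α q : ℝ) : ℝ :=
  (q * (Real.exp (α / 2) - 1) + 1) / (Real.exp (α / 2) + 1)

theorem integral_bit_rapporMix (α : ℝ) {k : ℕ} {p : Fin k → ℝ} (hp : p ∈ stdSimplex ℝ (Fin k))
    (y : Fin k) :
    ∫ b, (if b y then (1 : ℝ) else 0) ∂(rapporMix α p) = bitProb α (p y) := by
  have hflip : ∀ d : Bool, ∫ b, (if b then (1 : ℝ) else 0) ∂(flipLaw α d) =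
      if d then Real.exp (α / 2) / (Real.exp (α / 2) + 1) else 1 / (Real.exp (α / 2) + 1) := by
    intro d
    have h1 : 0 ≤ Real.exp (α / 2) / (Real.exp (α / 2) + 1) := by positivity
    have h2 : 0 ≤ (Real.exp (α / 2) + 1)⁻¹ := by positivity
    unfold flipLaw
    rw [integral_add_measure (Integrable.of_finite.smul_measure ENNReal.ofReal_ne_top)
        (Integrable.of_finite.smul_measure ENNReal.ofReal_ne_top), integral_smul_measure,
      integral_smul_measure, integral_dirac, integral_dirac]
    cases d <;> simp [ENNReal.toReal_ofReal h1, ENNReal.toReal_ofReal h2]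
  have hmsg : ∀ x, ∫ b, (if b y then (1 : ℝ) else 0) ∂(rapporMsg α x) =
      if y = x then Real.exp (α / 2) / (Real.exp (α / 2) + 1)
        else 1 / (Real.exp (α / 2) + 1) := fun x => by
    unfold rapporMsg
    rw [integral_comp_eval (μ := fun y => flipLaw α (decide (y = x))) (i := y)
      (f := fun b : Bool => if b then (1 : ℝ) else 0) (Measurable.of_discrete.aestronglyMeasurable),
      hflip]
    simp
  unfold rapporMix
  rw [integral_finsetSum_measure fun _ _ =>
    Integrable.of_finite.smul_measure ENNReal.ofReal_ne_top]
  simp only [integral_smul_measure, ENNReal.toReal_ofReal (hp.1 _), hmsg, smul_eq_mul]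
  have h3 : ∀ x, p x * (if y = x then Real.exp (α / 2) / (Real.exp (α / 2) + 1)
      else 1 / (Real.exp (α / 2) + 1)) = p x * (1 / (Real.exp (α / 2) + 1)) +
      if y = x then p x * ((Real.exp (α / 2) - 1) / (Real.exp (α / 2) + 1)) else 0 := fun x => by
    split_ifs <;> ring
  simp only [h3]
  rw [Finset.sum_add_distrib, ← Finset.sum_mul, hp.2, Finset.sum_ite_eq]
  simp only [Finset.mem_univ, if_true, bitProb]
  ring

theorem variance_bit_rapporMix (α : ℝ) {k : ℕ} {p : Fin k → ℝ} (hp : p ∈ stdSimplex ℝ (Fin k))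
    (y : Fin k) :
    Var[fun b => if b y then (1 : ℝ) else 0; rapporMix α p] =
      bitProb α (p y) * (1 - bitProb α (p y)) := by
  have := isProbabilityMeasure_rapporMix α hp
  rw [variance_eq_sub MemLp.of_discrete]
  have h : ((fun b : Fin k → Bool => if b y then (1 : ℝ) else 0) ^ 2) =
      fun b => if b y then (1 : ℝ) else 0 := by
    ext b
    simp
  rw [h, integral_bit_rapporMix α hp]
  ring

section Moments

variable {α : ℝ} {k n : ℕ} {p : Fin k → ℝ}

theorem integral_kRappor_est (hα : 0 < α) (hn : 0 < n) (hp : p ∈ stdSimplex ℝ (Fin k))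
    (y : Fin k) :
    ∫ t : Fin n → Fin k → Bool, (kRappor α k n).est t y ∂(Measure.pi fun _ => rapporMix α p) =
      p y := by
  have := isProbabilityMeasure_rapporMix α hp
  have he : 1 < Real.exp (α / 2) := Real.one_lt_exp_iff.2 (by linarith)
  have hn' : (n : ℝ) ≠ 0 := by positivity
  simp only [kRappor]
  rw [integral_sub Integrable.of_finite Integrable.of_finite, integral_const_mul, integral_div,
    integral_finsetSum _ fun _ _ => Integrable.of_finite]
  have h1 : ∀ i : Fin n, ∫ t : Fin n → Fin k → Bool, (if t i y then (1 : ℝ) else 0)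
      ∂(Measure.pi fun _ => rapporMix α p) = bitProb α (p y) := fun i => by
    rw [integral_comp_eval (μ := fun _ : Fin n => rapporMix α p) (i := i)
      (f := fun b : Fin k → Bool => if b y then (1 : ℝ) else 0)
      (Measurable.of_discrete.aestronglyMeasurable), integral_bit_rapporMix α hp]
  simp only [h1, Finset.sum_const, Finset.card_univ, Fintype.card_fin, nsmul_eq_mul,
    integral_const, probReal_univ, smul_eq_mul, one_mul, bitProb]
  have h2 : Real.exp (α / 2) - 1 ≠ 0 := by linarith
  have h3 : Real.exp (α / 2) + 1 ≠ 0 := by linarith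
  field_simp
  ring

theorem variance_kRappor_est (hn : 0 < n) (hp : p ∈ stdSimplex ℝ (Fin k)) (y : Fin k) :
    Var[fun t : Fin n → Fin k → Bool => (kRappor α k n).est t y;
      Measure.pi fun _ => rapporMix α p] =
      ((Real.exp (α / 2) + 1) / (Real.exp (α / 2) - 1)) ^ 2 *
        (bitProb α (p y) * (1 - bitProb α (p y))) / n := by
  have := isProbabilityMeasure_rapporMix α hp
  have hn' : (n : ℝ) ≠ 0 := by positivity
  simp only [kRappor]
  rw [variance_sub_const Measurable.of_discrete.aestronglyMeasurable, variance_const_mul]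
  simp only [div_eq_mul_inv _ (n : ℝ)]
  rw [variance_mul_const]
  have h1 := variance_sum_pi (μ := fun _ : Fin n => rapporMix α p)
    (X := fun _ b => if b y then (1 : ℝ) else 0) fun _ => MemLp.of_discrete
  have h2 : (∑ i : Fin n, fun t : Fin n → Fin k → Bool => if t i y then (1 : ℝ) else 0) =
      fun t => ∑ i : Fin n, if t i y then (1 : ℝ) else 0 := by
    ext t; simp
  rw [h2] at h1
  rw [h1, variance_bit_rapporMix α hp, Finset.sum_const, Finset.card_univ, Fintype.card_fin,
    nsmul_eq_mul]
  field_simp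

end Moments

theorem uniform_mem_stdSimplex {k : ℕ} (hk : 0 < k) : uniform k ∈ stdSimplex ℝ (Fin k) := by
  have hk' : (k : ℝ) ≠ 0 := by positivity
  exact ⟨fun _ => by unfold uniform; positivity, by simp [uniform, hk']⟩

/-! ### Two-sided variance bounds and the comparison of risks -/

section Bounds

variable {α : ℝ} {k n : ℕ} {p : Fin k → ℝ}

theorem variance_kRappor_est_le (hα0 : 0 < α) (hα1 : α < 1) (hn : 0 < n)
    (hp : p ∈ stdSimplex ℝ (Fin k)) (y : Fin k) :
    Var[fun t : Fin n → Fin k → Bool => (kRappor α k n).est t y;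
      Measure.pi fun _ => rapporMix α p] ≤ (3 / (α * √n)) ^ 2 := by
  have hn' : (0 : ℝ) < n := by exact_mod_cast hn
  have he : α / 2 ≤ Real.exp (α / 2) - 1 := by linarith [Real.add_one_le_exp (α / 2)]
  have he2 : Real.exp (α / 2) + 1 ≤ 3 := by
    have := Real.abs_exp_sub_one_le (x := α / 2) (by rw [abs_of_pos (by linarith)]; linarith)
    rw [abs_of_pos (by linarith : 0 < α / 2)] at this
    linarith [le_abs_self (Real.exp (α / 2) - 1)]
  -- Numerator at most `3`, denominator at least `α / 2`.
  have hA : (Real.exp (α / 2) + 1) / (Real.exp (α / 2) - 1) ≤ 6 / α := by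
    rw [div_le_div_iff₀ (by linarith) hα0]
    nlinarith
  have hA0 : 0 ≤ (Real.exp (α / 2) + 1) / (Real.exp (α / 2) - 1) :=
    div_nonneg (by positivity) (by linarith)
  rw [variance_kRappor_est hn hp]
  have h1 : ((Real.exp (α / 2) + 1) / (Real.exp (α / 2) - 1)) ^ 2 ≤ (6 / α) ^ 2 := by gcongr
  have h2 : bitProb α (p y) * (1 - bitProb α (p y)) ≤ 1 / 4 := by
    nlinarith [sq_nonneg (bitProb α (p y) - 1 / 2)]
  have h3 : (3 / (α * √n)) ^ 2 = (6 / α) ^ 2 * (1 / 4) / n := by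
    rw [div_pow, mul_pow, Real.sq_sqrt hn'.le]
    field_simp
    norm_num
  rw [h3]
  exact div_le_div_of_nonneg_right ((mul_le_mul_of_nonneg_left h2 (sq_nonneg _)).trans
    (mul_le_mul_of_nonneg_right h1 (by norm_num))) hn'.le

theorem le_variance_kRappor_est (hα0 : 0 < α) (hα1 : α < 1) (hn : 0 < n)
    (hp : p ∈ stdSimplex ℝ (Fin k)) (y : Fin k) :
    1 / (α ^ 2 * n) ≤ Var[fun t : Fin n → Fin k → Bool => (kRappor α k n).est t y;
      Measure.pi fun _ => rapporMix α p] := by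
  have hn' : (0 : ℝ) < n := by exact_mod_cast hn
  have he : 0 < Real.exp (α / 2) - 1 := by linarith [Real.add_one_le_exp (α / 2)]
  have he2 : Real.exp (α / 2) - 1 ≤ α := by
    have := Real.abs_exp_sub_one_le (x := α / 2) (by rw [abs_of_pos (by linarith)]; linarith)
    rw [abs_of_pos (by linarith : 0 < α / 2)] at this
    linarith [le_abs_self (Real.exp (α / 2) - 1)]
  have hq0 := hp.1 y
  have hq1 : p y ≤ 1 := by
    rw [← hp.2]; exact Finset.single_le_sum (fun x _ => hp.1 x) (Finset.mem_univ y)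
  rw [variance_kRappor_est hn hp, ← div_div]
  refine div_le_div_of_nonneg_right ?_ hn'.le
  unfold bitProb
  set u := Real.exp (α / 2) - 1 with hu
  have hu1 : Real.exp (α / 2) + 1 = u + 2 := by rw [hu]; ring
  rw [hu1]
  -- After cancelling `u + 2`, the numerator is a product of two factors at least `1`, and `u ≤ α`.
  have h1 : ((u + 2) / u) ^ 2 * ((p y * u + 1) / (u + 2) * (1 - (p y * u + 1) / (u + 2))) =
      (p y * u + 1) * (1 + (1 - p y) * u) / u ^ 2 := by
    have : u + 2 ≠ 0 := by linarith
    field_simp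
    ring
  rw [h1]
  refine div_le_div₀ (by positivity) ?_ (by positivity) (by gcongr)
  have h2 : 0 ≤ p y * u := by positivity
  have h3 : 0 ≤ (1 - p y) * u := mul_nonneg (by linarith) he.le
  nlinarith

/-- Integrates the pointwise AM-GM bound `|X| ≤ X² / (2 s) + s / 2`. -/
theorem integral_abs_le_of_sq {T : Type*} [MeasurableSpace T] {μ : Measure T}
    [IsProbabilityMeasure μ] {X : T → ℝ} (hX : Integrable X μ)
    (hX2 : Integrable (fun t => X t ^ 2) μ) {s : ℝ} (hs : 0 < s) (h : ∫ t, X t ^ 2 ∂μ ≤ s ^ 2) :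
    ∫ t, |X t| ∂μ ≤ s := by
  calc ∫ t, |X t| ∂μ ≤ ∫ t, (X t ^ 2 / (2 * s) + s / 2) ∂μ := by
        refine integral_mono hX.abs ((hX2.div_const _).add (integrable_const _)) fun t => ?_
        have h1 : X t ^ 2 / (2 * s) + s / 2 - |X t| = (|X t| - s) ^ 2 / (2 * s) := by
          rw [← sq_abs]; field_simp; ring
        have h2 : 0 ≤ (|X t| - s) ^ 2 / (2 * s) := by positivity
        simp only
        linarith
    _ = (∫ t, X t ^ 2 ∂μ) / (2 * s) + s / 2 := by
        rw [integral_add (hX2.div_const _) (integrable_const _), integral_div]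
        simp
    _ ≤ s ^ 2 / (2 * s) + s / 2 := by gcongr
    _ = s := by field_simp; ring

theorem kRappor_worstRisk_le (hα0 : 0 < α) (hα1 : α < 1) (hn : 0 < n) :
    (kRappor α k n).worstRisk ≤ ENNReal.ofReal (k * (3 / (α * √n))) := by
  have hn' : (0 : ℝ) < n := by exact_mod_cast hn
  refine iSup₂_le fun p hp => ?_
  have := isProbabilityMeasure_rapporMix α hp
  unfold Protocol.risk
  rw [kRappor_lawUnder α k n hp]
  refine (ofReal_integral_eq_lintegral_ofReal (α := Fin n → Fin k → Bool)
    (f := fun t => ∑ x, |(kRappor α k n).est t x - p x|) Integrable.of_finite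
    (Filter.Eventually.of_forall fun t => Finset.sum_nonneg fun _ _ => abs_nonneg _)).symm.le.trans ?_
  refine ENNReal.ofReal_le_ofReal ?_
  rw [integral_finsetSum _ fun _ _ => Integrable.of_finite]
  calc ∑ x, ∫ t : Fin n → Fin k → Bool, |(kRappor α k n).est t x - p x|
        ∂(Measure.pi fun _ => rapporMix α p) ≤ ∑ x : Fin k, 3 / (α * √n) := by
        refine Finset.sum_le_sum fun x _ => ?_
        refine integral_abs_le_of_sq Integrable.of_finite Integrable.of_finite
          (by positivity) ?_
        refine le_trans (le_of_eq ?_) (variance_kRappor_est_le hα0 hα1 hn hp x)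
        rw [variance_eq_integral Measurable.of_discrete.aemeasurable,
          integral_kRappor_est hα0 hn hp]
    _ = k * (3 / (α * √n)) := by simp

theorem le_kRappor_collisionError (hα0 : 0 < α) (hα1 : α < 1) (hn : 0 < n)
    (hp : p ∈ stdSimplex ℝ (Fin k)) :
    ENNReal.ofReal (k * (1 / (α ^ 2 * n))) ≤ (kRappor α k n).collisionError p := by
  have := isProbabilityMeasure_rapporMix α hp
  unfold Protocol.collisionError
  rw [kRappor_lawUnder α k n hp]
  refine le_trans ?_ (ofReal_integral_eq_lintegral_ofReal (α := Fin n → Fin k → Bool)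
    (f := fun t => |collision ((kRappor α k n).est t) - collision p|) Integrable.of_finite
    (Filter.Eventually.of_forall fun t => abs_nonneg _)).le
  refine ENNReal.ofReal_le_ofReal (le_trans ?_ (abs_integral_le_integral_abs
    (f := fun t : Fin n → Fin k → Bool => collision ((kRappor α k n).est t) - collision p)))
  refine le_trans ?_ (le_abs_self _)
  unfold collision
  simp only [← Finset.sum_sub_distrib]
  rw [integral_finsetSum _ fun _ _ => Integrable.of_finite]
  calc (k : ℝ) * (1 / (α ^ 2 * n)) = ∑ x : Fin k, 1 / (α ^ 2 * n) := by simp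
    _ ≤ _ := by
      -- As the estimate is unbiased, the bias of its square is its variance.
      refine Finset.sum_le_sum fun x _ => (le_variance_kRappor_est hα0 hα1 hn hp x).trans ?_
      rw [variance_eq_sub MemLp.of_discrete, integral_kRappor_est hα0 hn hp,
        integral_sub Integrable.of_finite Integrable.of_finite]
      simp

theorem Protocol.IsLDP.le_worstRisk_of_le {B : Protocol k n} {γ : ℝ} (hB : B.IsLDP α 0)
    (hα0 : 0 < α) (hα1 : α < 1) (hk : 2 ≤ k) (hγ0 : 0 ≤ γ) (hγ1 : γ ≤ 1)
    (hn : 84 * (γ * (α * √n)) ≤ k) : ENNReal.ofReal (3 / 4 * γ) ≤ B.worstRisk := by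
  obtain ⟨e⟩ : Nonempty (Fin (k / 2) × Bool ↪ Fin k) :=
    Function.Embedding.nonempty_of_card_le (by simp; omega)
  refine hB.le_worstRisk hα0 hα1 hγ0 hγ1 (by omega) e ?_
  -- The cube uses `m = ⌊k / 2⌋ ≥ k / 3` pairs; thus `84 = 3 * 28`, with `28² = 784 ≥ 768`.
  have h3 : (k : ℝ) ≤ 3 * ((k / 2 : ℕ) : ℝ) := by
    have : k ≤ 3 * (k / 2) := by omega
    exact_mod_cast this
  have h1 : 28 * (γ * (α * √n)) ≤ ((k / 2 : ℕ) : ℝ) := by linarith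
  have h2 : (28 * (γ * (α * √n))) ^ 2 ≤ ((k / 2 : ℕ) : ℝ) ^ 2 := by gcongr
  have h4 : (28 * (γ * (α * √n))) ^ 2 = 784 * n * (γ * α) ^ 2 := by
    have := Real.sq_sqrt (Nat.cast_nonneg (α := ℝ) n)
    linear_combination 784 * (γ * α) ^ 2 * this
  have h5 : 0 ≤ (n : ℝ) * (γ * α) ^ 2 := by positivity
  linarith

theorem min_worstRisk_kRappor_le (hα0 : 0 < α) (hα1 : α < 1) (hk : 2 ≤ k) (hn : 0 < n)
    {B : Protocol k n} (hB : B.IsLDP α 0) :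
    min 2 (kRappor α k n).worstRisk ≤ ENNReal.ofReal 336 * B.worstRisk := by
  have hn' : (0 : ℝ) < n := by exact_mod_cast hn
  have hd : 0 < α * √n := by positivity
  -- With few users, `γ = 1` is allowed and every private estimator has risk at least `3 / 4`.
  -- Otherwise the largest allowed `γ = k / (84 α √n)` gives the lower bound `k / (112 α √n)`, which
  -- is the upper bound `3 k / (α √n)` divided by `336`.
  by_cases h : 84 * (α * √n) ≤ k
  · have hw := hB.le_worstRisk_of_le hα0 hα1 hk zero_le_one le_rfl (by linarith)
    calc min 2 (kRappor α k n).worstRisk ≤ 2 := min_le_left _ _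
      _ = ENNReal.ofReal 2 := by simp
      _ ≤ ENNReal.ofReal (336 * (3 / 4 * 1)) := ENNReal.ofReal_le_ofReal (by norm_num)
      _ = ENNReal.ofReal 336 * ENNReal.ofReal (3 / 4 * 1) := ENNReal.ofReal_mul (by norm_num)
      _ ≤ _ := mul_le_mul_right hw _
  · push Not at h
    have hw := hB.le_worstRisk_of_le (γ := k / (84 * (α * √n))) hα0 hα1 hk (by positivity)
      ((div_le_one (by positivity)).2 h.le) (by
        refine le_of_eq ?_
        field_simp)
    calc min 2 (kRappor α k n).worstRisk ≤ (kRappor α k n).worstRisk := min_le_right _ _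
      _ ≤ ENNReal.ofReal (k * (3 / (α * √n))) := kRappor_worstRisk_le hα0 hα1 hn
      _ = ENNReal.ofReal (336 * (3 / 4 * (k / (84 * (α * √n))))) := by
          congr 1
          field_simp
          norm_num
      _ = ENNReal.ofReal 336 * ENNReal.ofReal (3 / 4 * (k / (84 * (α * √n)))) :=
          ENNReal.ofReal_mul (by norm_num)
      _ ≤ _ := mul_le_mul_right hw _

theorem worstRisk_kRappor_le_of_le {m : ℕ} (hα0 : 0 < α) (hα1 : α < 1) (hk : 2 ≤ k) {τ : ℝ}
    (hτ0 : 0 < τ) (hτ : τ ≤ 1 / 2) {B : Protocol k m} (hB : B.IsLDP α 0)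
    (hBτ : B.worstRisk ≤ ENNReal.ofReal τ) (hn : 336 ^ 2 * (m : ℝ) ≤ n) :
    (kRappor α k n).worstRisk ≤ ENNReal.ofReal τ := by
  have hk' : (0 : ℝ) < k := by positivity
  have hlow : ∀ γ : ℝ, 0 ≤ γ → γ ≤ 1 → 84 * (γ * (α * √m)) ≤ k → 3 / 4 * γ ≤ τ :=
    fun γ h0 h1 h => (ENNReal.ofReal_le_ofReal_iff hτ0.le).1
      ((hB.le_worstRisk_of_le hα0 hα1 hk h0 h1 h).trans hBτ)
  -- Here `τ ≤ 1 / 2 < 3 / 4` excludes the regime of few users, including `m = 0`.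
  have hbig : (k : ℝ) < 84 * (α * √m) := by
    by_contra! h
    have := hlow 1 zero_le_one le_rfl (by linarith)
    linarith
  have hd : 0 < α * √m := by linarith
  have hm : 0 < √(m : ℝ) := pos_of_mul_pos_right hd hα0.le
  have h1 := hlow (k / (84 * (α * √m))) (by positivity)
    ((div_le_one (by positivity)).2 hbig.le) (by
      refine le_of_eq ?_
      field_simp)
  have hsqrt : 336 * √m ≤ √n := by
    refine Real.le_sqrt_of_sq_le ?_
    rw [mul_pow, Real.sq_sqrt (Nat.cast_nonneg m)]
    exact hn
  have hsn : 0 < √(n : ℝ) := by linarith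
  have hn0 : 0 < n := by exact_mod_cast Real.sqrt_pos.1 hsn
  refine (kRappor_worstRisk_le hα0 hα1 hn0).trans (ENNReal.ofReal_le_ofReal ?_)
  calc (k : ℝ) * (3 / (α * √n)) ≤ k * (3 / (α * (336 * √m))) := by gcongr
    _ = 3 / 4 * (k / (84 * (α * √m))) := by field_simp; norm_num
    _ ≤ τ := h1

end Bounds

end LDP

theorem theorem4 :
    ∃ K : ℝ, 0 < K ∧ ∃ c : ℝ, 0 < c ∧
      ∀ α : ℝ, 0 < α → α < 1 → ∀ k : ℕ, 2 ≤ k →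
        LDP.IsMinimaxOptimalWithin K α 0 (LDP.kRappor α k) ∧
        LDP.uniform k ∈ stdSimplex ℝ (Fin k) ∧
        ∀ n : ℕ, 1 ≤ n → ∀ ε : ℝ, 0 < ε →
          (LDP.kRappor α k n).collisionError (LDP.uniform k) ≤ ENNReal.ofReal ε →
            c * min ((k : ℝ) ^ 2 / α ^ 2) (k / (α ^ 2 * ε)) ≤ n := by
  -- The risk bounds differ by a factor `336` and scale as `1 / √n`, so matching an accuracy costs a
  -- factor `336²` in users.
  refine ⟨336 ^ 2, by norm_num, 1, one_pos, fun α hα0 hα1 k hk => ⟨⟨?_, ?_, ?_⟩,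
    LDP.uniform_mem_stdSimplex (by omega), ?_⟩⟩
  · exact fun n => LDP.kRappor_isLDP hα0.le k n
  · intro n hn B hB
    refine (LDP.min_worstRisk_kRappor_le hα0 hα1 hk hn hB).trans (mul_le_mul_left ?_ _)
    exact ENNReal.ofReal_le_ofReal (by norm_num)
  · exact fun τ hτ0 hτ m B hB hBτ n hn =>
      LDP.worstRisk_kRappor_le_of_le hα0 hα1 hk hτ0 hτ hB hBτ hn
  · intro n hn ε hε h
    have hn' : (0 : ℝ) < n := by exact_mod_cast hn
    have h1 := (ENNReal.ofReal_le_ofReal_iff hε.le).1 ((LDP.le_kRappor_collisionError hα0 hα1 hn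
      (LDP.uniform_mem_stdSimplex (by omega : 0 < k))).trans h)
    rw [one_mul]
    -- The bias alone yields `n ≥ k / (α² ε)`, which dominates the minimum.
    refine (min_le_right _ _).trans ?_
    rw [mul_one_div, div_le_iff₀ (by positivity)] at h1
    rw [div_le_iff₀ (by positivity)]
    linarith
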